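/- Let $d\ge 1$, let $\Box:=(-\frac12,\frac12)^d$ denote the unit box in $\mathbb R^d$, write $R\Box:=\{Rx : x\in\Box\}$ for $R>0$, and let $\operatorname{avg}_A f:=\frac{1}{|A|}\int_A f$ denote the average of $f$ over $A$. Let $u\in H^1_{\mathrm{loc}}(\mathbb R^d)$ be real-valued, with weak gradient $\nabla u$, and suppose that $\operatorname{avg}_{\Box}u=0$, $$\limsup_{R\to\infty}\operatorname{avg}_{R\Box}|\nabla u|^2<\infty,\qquad\text{and}\qquad \lim_{R\to\infty}\frac{1}{|R\Box|}\int_{R\Box}\nabla u(x)\cdot F\big(\tfrac{x}{R}\big)\,dx=0\quad\text{for all }F\in L^2(\Box,\mathbb R^d).$$ Then $$\lim_{R\to\infty}\Big(\frac1{R^2}\operatorname{avg}_{R\Box}\Big|u-\operatorname{avg}_{R\Box}u\Big|^2\Big)^{\frac12}=0\qquad\text{and}\qquad \lim_{R\to\infty}\Big(\frac1{R^2}\operatorname{avg}_{R\Box}|u|^2\Big)^{\frac12}=0.$$ -/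

import Mathlib

open MeasureTheory Filter Topology
open scoped ContDiff Pointwise

/-- The unit box `□ = (-1/2, 1/2)^d` in `ℝ^d`. Its dilation `R□` is `R • unitBox d`. -/
def unitBox (d : ℕ) : Set (EuclideanSpace ℝ (Fin d)) :=
  {x | ∀ i, x i ∈ Set.Ioo (-(1 / 2) : ℝ) (1 / 2)}

/-- `f ∈ L²_loc(ℝ^d; E)`: `f` is square integrable on every compact subset of `ℝ^d`. -/
def MemL2loc {d : ℕ} {E : Type*} [NormedAddCommGroup E]
    (f : EuclideanSpace ℝ (Fin d) → E) : Prop :=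
  ∀ K : Set (EuclideanSpace ℝ (Fin d)), IsCompact K → MemLp f 2 (volume.restrict K)

/-- `g` is the weak (distributional) gradient of `u` on `ℝ^d`:
`∫ u ∂ᵢφ = - ∫ gᵢ φ` for every `φ ∈ C_c^∞(ℝ^d)` and every `i`. -/
def HasWeakGradient {d : ℕ} (u : EuclideanSpace ℝ (Fin d) → ℝ)
    (g : EuclideanSpace ℝ (Fin d) → EuclideanSpace ℝ (Fin d)) : Prop :=
  ∀ φ : EuclideanSpace ℝ (Fin d) → ℝ, ContDiff ℝ ∞ φ → HasCompactSupport φ →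
    ∀ i : Fin d,
      ∫ x, u x * fderiv ℝ φ x (EuclideanSpace.single i 1) = - ∫ x, g x i * φ x

/-- `u ∈ H¹_loc(ℝ^d)` with weak gradient `∇u = g` (determined by `u` up to a null set). -/
structure IsH1loc {d : ℕ} (u : EuclideanSpace ℝ (Fin d) → ℝ)
    (g : EuclideanSpace ℝ (Fin d) → EuclideanSpace ℝ (Fin d)) : Prop where
  memL2loc : MemL2loc u
  memL2loc_grad : MemL2loc g
  hasWeakGradient : HasWeakGradient u g

section

open Metric Set ContinuousLinearMap
open scoped ENNReal Convolution

/-! Blow down: `v_R(x) = R⁻¹ u(Rx)` has gradient `Du(Rx)`, bounded in `L²` of the unit box for large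
`R` and tending weakly to `0`. Rellich compactness then forces `v_R` to approach constants in `L²`.
This is `eventually_exists_lintegral_ball_sub_sq_le`, proved directly: mollifying at scale `δ` costs
at most `δ` times the `L²` norm of the gradient, uniformly in `R`, while the mollified gradients are
pairings of `Du(R·)` with fixed test fields, hence tend to `0` pointwise and boundedly. The mean is
the best constant in `L²`, which gives the first limit.

For the second, let `m(R)` be the mean over `R□`. Comparing `R□` with `(R/2)□` bounds `|m(R/2) -
m(R)|` by `o(R)`, so `b(R) = |m(R)|/R` satisfies `b(R) ≤ b(R/2)/2 + o(1)`. The factor `1/2` makes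
this a contraction, and `b → 0` by `tendsto_zero_of_le_half_add`. Finally the mean square is the
variance plus `m(R)²`. -/

theorem sq_lintegral_mul_le {α : Type*} [MeasurableSpace α] {μ : Measure α} {k f : α → ℝ≥0∞}
    (hk : AEMeasurable k μ) (hf : AEMeasurable f μ) (h1 : ∫⁻ x, k x ∂μ ≤ 1) :
    (∫⁻ x, k x * f x ∂μ) ^ 2 ≤ ∫⁻ x, k x * f x ^ 2 ∂μ := by
  have h := ENNReal.lintegral_mul_norm_pow_le (μ := μ) (p := 1 / 2) (q := 1 / 2) hk
    (hk.mul (hf.pow_const 2)) (by norm_num) (by norm_num) (by norm_num)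
  have e : ∀ x, k x ^ (1 / 2 : ℝ) * (k x * f x ^ 2) ^ (1 / 2 : ℝ) = k x * f x := fun x ↦ by
    rw [ENNReal.mul_rpow_of_nonneg _ _ (by norm_num), ← mul_assoc,
      ← ENNReal.rpow_add_of_nonneg _ _ (by norm_num) (by norm_num), ← ENNReal.rpow_natCast,
      ← ENNReal.rpow_mul]
    norm_num
  simp only [Pi.mul_apply, e] at h
  have h' : ∫⁻ x, k x * f x ∂μ ≤ (∫⁻ x, k x * f x ^ 2 ∂μ) ^ (1 / 2 : ℝ) := by
    refine h.trans ?_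
    refine (mul_le_mul_left (ENNReal.rpow_le_one h1 (by norm_num)) _).trans ?_
    rw [one_mul]
  refine (pow_le_pow_left' h' 2).trans ?_
  rw [← ENNReal.rpow_natCast, ← ENNReal.rpow_mul]
  norm_num

/-! ### Translation and convolution estimates on balls -/

section

variable {E : Type*} [NormedAddCommGroup E]

theorem setLIntegral_ball_add_right_le [MeasurableSpace E] [BorelSpace E] {μ : Measure E}
    [μ.IsAddRightInvariant] (f : E → ℝ≥0∞) {r s : ℝ} {h : E} (hs : r + ‖h‖ ≤ s) :
    ∫⁻ x in ball 0 r, f (x + h) ∂μ ≤ ∫⁻ x in ball 0 s, f x ∂μ := by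
  rw [← lintegral_indicator measurableSet_ball, ← lintegral_indicator measurableSet_ball,
    ← lintegral_add_right_eq_self (indicator (ball 0 s) f) h]
  refine lintegral_mono (indicator_le fun x hx ↦ ?_)
  rw [indicator_of_mem]
  rw [mem_ball_zero_iff] at hx ⊢
  linarith [norm_add_le x h]

/-- The fundamental theorem of calculus along the segment from `x` to `x + h`, then Cauchy–Schwarz
on `[0, 1]`. It serves both for translations and, with `x = 0`, for rays from the origin. -/
theorem enorm_sub_sq_le_lintegral_fderiv [NormedSpace ℝ E] {w : E → ℝ} (hw : ContDiff ℝ 1 w)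
    (x h : E) :
    ‖w (x + h) - w x‖ₑ ^ 2 ≤
      ‖h‖ₑ ^ 2 * ∫⁻ t in Icc (0 : ℝ) 1, ‖fderiv ℝ w (x + t • h)‖ₑ ^ 2 := by
  have hc : Continuous fun t : ℝ ↦ fderiv ℝ w (x + t • h) :=
    (hw.continuous_fderiv one_ne_zero).comp (by fun_prop)
  have hF : w (x + h) - w x = ∫ t in (0 : ℝ)..1, fderiv ℝ w (x + t • h) h := by
    rw [intervalIntegral.integral_eq_sub_of_hasDerivAt (f := fun t : ℝ ↦ w (x + t • h))]
    · simp
    · intro t _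
      have h1 : HasDerivAt (fun t : ℝ ↦ x + t • h) h t := by
        simpa using ((hasDerivAt_id t).smul_const h).const_add x
      exact ((hw.differentiable one_ne_zero _).hasFDerivAt).comp_hasDerivAt t h1
    · exact (hc.clm_apply continuous_const).intervalIntegrable _ _
  have h1 : ‖w (x + h) - w x‖ₑ ≤
      ‖h‖ₑ * ∫⁻ t in Icc (0 : ℝ) 1, ‖fderiv ℝ w (x + t • h)‖ₑ := by
    rw [hF, intervalIntegral.integral_of_le zero_le_one, ← integral_Icc_eq_integral_Ioc,
      ← lintegral_const_mul' _ _ enorm_ne_top]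
    refine (enorm_integral_le_lintegral_enorm _).trans (lintegral_mono fun t ↦ ?_)
    rw [mul_comm]
    exact le_opENorm _ _
  refine (pow_le_pow_left' h1 2).trans ?_
  rw [mul_pow]
  gcongr
  have := sq_lintegral_mul_le (μ := volume.restrict (Icc (0 : ℝ) 1)) (k := fun _ ↦ 1)
    (f := fun t ↦ ‖fderiv ℝ w (x + t • h)‖ₑ) aemeasurable_const
    hc.enorm.measurable.aemeasurable (by simp)
  simpa using this

variable [NormedSpace ℝ E] [FiniteDimensional ℝ E] [MeasurableSpace E] [BorelSpace E]
  (μ : Measure E) [μ.IsAddHaarMeasure]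

theorem lintegral_ball_translate_sub_sq_le_of_contDiff {w : E → ℝ} (hw : ContDiff ℝ 1 w)
    {r s : ℝ} {h : E} (hs : r + ‖h‖ ≤ s) :
    ∫⁻ x in ball 0 r, ‖w (x + h) - w x‖ₑ ^ 2 ∂μ ≤
      ‖h‖ₑ ^ 2 * ∫⁻ x in ball 0 s, ‖fderiv ℝ w x‖ₑ ^ 2 ∂μ := by
  have hc : Continuous fun p : E × ℝ ↦ ‖fderiv ℝ w (p.1 + p.2 • h)‖ₑ ^ 2 :=
    ENNReal.continuous_pow 2 |>.comp
      ((hw.continuous_fderiv one_ne_zero).comp (by fun_prop)).enorm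
  calc _ ≤ ∫⁻ x in ball 0 r, (‖h‖ₑ ^ 2 *
        ∫⁻ t in Icc (0 : ℝ) 1, ‖fderiv ℝ w (x + t • h)‖ₑ ^ 2) ∂μ :=
        lintegral_mono fun x ↦ enorm_sub_sq_le_lintegral_fderiv hw x h
    _ = ‖h‖ₑ ^ 2 * ∫⁻ t in Icc (0 : ℝ) 1,
          ∫⁻ x in ball 0 r, ‖fderiv ℝ w (x + t • h)‖ₑ ^ 2 ∂μ := by
        rw [lintegral_const_mul' _ _ (ENNReal.pow_ne_top enorm_ne_top),
          lintegral_lintegral_swap hc.measurable.aemeasurable]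
    _ ≤ ‖h‖ₑ ^ 2 * ∫⁻ t in Icc (0 : ℝ) 1,
          ∫⁻ x in ball 0 s, ‖fderiv ℝ w x‖ₑ ^ 2 ∂μ := by
        refine mul_le_mul_right ?_ _
        refine setLIntegral_mono' measurableSet_Icc fun t ht ↦ ?_
        refine setLIntegral_ball_add_right_le (fun x ↦ ‖fderiv ℝ w x‖ₑ ^ 2) ?_
        rw [norm_smul, Real.norm_of_nonneg ht.1]
        nlinarith [ht.2, norm_nonneg h]
    _ = _ := by simp

/-- After Tonelli, each `y` in the support of the kernel shifts the small ball to one inside the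
large ball, and the kernel has mass at most one. -/
theorem lintegral_ball_lintegral_kernel_sub_le {k f : E → ℝ≥0∞} (hk : Measurable k)
    (hf : Measurable f) (h1 : ∫⁻ x, k x ∂μ ≤ 1) {δ r s : ℝ} (hkδ : ∀ x, x ∉ ball 0 δ → k x = 0)
    (hs : r + δ ≤ s) :
    ∫⁻ x in ball 0 r, ∫⁻ y, k y * f (x - y) ∂μ ∂μ ≤ ∫⁻ x in ball 0 s, f x ∂μ := by
  rw [lintegral_lintegral_swap (by fun_prop)]
  calc _ ≤ ∫⁻ y, k y * (∫⁻ x in ball 0 s, f x ∂μ) ∂μ := by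
        refine lintegral_mono fun y ↦ ?_
        rw [lintegral_const_mul _ (by fun_prop)]
        by_cases hy : y ∈ ball 0 δ
        · refine mul_le_mul_right ?_ _
          simp only [sub_eq_add_neg]
          refine setLIntegral_ball_add_right_le f ?_
          rw [norm_neg]
          rw [mem_ball_zero_iff] at hy
          linarith
        · simp [hkδ y hy]
    _ ≤ _ := by
        rw [lintegral_mul_const _ hk]
        exact mul_le_of_le_one_left' h1

end

/-! ### A halving recursion and the variance identity -/

theorem tendsto_zero_of_le_half_add {b : ℝ → ℝ} (hb : ∀ R, 0 < R → 0 ≤ b R)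
    (hbdd : ∀ R₀, 0 < R₀ → ∃ K, ∀ R ∈ Set.Icc R₀ (2 * R₀), b R ≤ K)
    (h : ∀ ε > 0, ∀ᶠ R in atTop, b R ≤ b (R / 2) / 2 + ε) : Tendsto b atTop (𝓝 0) := by
  have hmain : ∀ ε > 0, ∀ᶠ R in atTop, b R ≤ 3 * ε := by
    intro ε hε
    obtain ⟨R₀, hR₀⟩ := ((h ε hε).and (eventually_gt_atTop 0)).exists_forall_of_atTop
    have hpos : 0 < R₀ := (hR₀ R₀ le_rfl).2
    obtain ⟨K, hK⟩ := hbdd (R₀ / 2) (by positivity)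
    have hK0 : 0 ≤ K := (hb R₀ hpos).trans (hK R₀ ⟨by linarith, by linarith⟩)
    -- Here `2 * ε` is the fixed point of `t ↦ t / 2 + ε`, so the bound survives each doubling of
    -- the range of `R`. Once it holds for all `R ≥ R₀`, the second induction halves the excess `K`
    -- at each doubling.
    have h1 : ∀ n : ℕ, ∀ R ∈ Set.Icc (R₀ / 2) (2 ^ n * R₀), b R ≤ K + 2 * ε := by
      intro n
      induction n with
      | zero =>
        intro R hR
        have := hK R ⟨hR.1, by linarith [hR.2]⟩
        linarith
      | succ n ih =>
        intro R hR
        rcases le_total R R₀ with hle | hle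
        · have := hK R ⟨hR.1, by linarith⟩
          linarith
        · have h2 := (hR₀ R hle).1
          have h3 := ih (R / 2) ⟨by linarith, by have := hR.2; rw [pow_succ] at this; linarith⟩
          linarith
    have h1' : ∀ R ≥ R₀, b R ≤ K + 2 * ε := by
      intro R hR
      obtain ⟨n, hn⟩ := pow_unbounded_of_one_lt (R / R₀) (one_lt_two (α := ℝ))
      exact h1 n R ⟨by linarith, by rw [div_lt_iff₀ hpos] at hn; exact hn.le⟩
    have h2 : ∀ n : ℕ, ∀ R ≥ 2 ^ n * R₀, b R ≤ K / 2 ^ n + 2 * ε := by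
      intro n
      induction n with
      | zero => simpa using h1'
      | succ n ih =>
        intro R hR
        have h4 : R₀ ≤ R := by
          refine le_trans ?_ hR
          nlinarith [one_le_pow₀ (one_le_two (α := ℝ)) (n := n + 1)]
        have h3 := ih (R / 2) (by rw [pow_succ] at hR; linarith)
        have h5 := (hR₀ R h4).1
        have : K / 2 ^ (n + 1) = K / 2 ^ n / 2 := by rw [pow_succ, div_div]
        linarith
    obtain ⟨n, hn⟩ := pow_unbounded_of_one_lt (K / ε) (one_lt_two (α := ℝ))
    filter_upwards [eventually_ge_atTop (2 ^ n * R₀)] with R hR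
    have h3 := h2 n R hR
    have : K / 2 ^ n ≤ ε := by
      rw [div_lt_iff₀ hε] at hn
      rw [div_le_iff₀ (by positivity)]
      linarith
    linarith
  rw [Metric.tendsto_atTop']
  intro ε hε
  obtain ⟨N, hN⟩ := ((hmain (ε / 4) (by positivity)).and
    (eventually_gt_atTop 0)).exists_forall_of_atTop
  refine ⟨N, fun R hR ↦ ?_⟩
  rw [Real.dist_0_eq_abs, abs_of_nonneg (hb R (hN R hR.le).2)]
  linarith [(hN R hR.le).1]

theorem integral_sub_const_sq {Ω : Type*} [MeasurableSpace Ω] {μ : Measure Ω}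
    [IsProbabilityMeasure μ] {f : Ω → ℝ} (hf : MemLp f 2 μ) (c : ℝ) :
    ∫ x, |f x - c| ^ 2 ∂μ =
      ∫ x, |f x - ∫ y, f y ∂μ| ^ 2 ∂μ + (∫ y, f y ∂μ - c) ^ 2 := by
  have hi : Integrable f μ := hf.integrable (by norm_num)
  have key : ∀ a : ℝ, ∫ x, |f x - a| ^ 2 ∂μ = ∫ x, f x ^ 2 ∂μ - 2 * a * ∫ x, f x ∂μ + a ^ 2 := by
    intro a
    have e : ∀ x, |f x - a| ^ 2 = f x ^ 2 - 2 * a * f x + a ^ 2 := fun x ↦ by rw [sq_abs]; ring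
    simp only [e]
    have h1 := hf.integrable_sq.sub (hi.const_mul (2 * a))
    rw [integral_add (f := fun x ↦ f x ^ 2 - 2 * a * f x) h1 (integrable_const _),
      integral_sub hf.integrable_sq (hi.const_mul _), integral_const_mul]
    simp
  rw [key, key]
  ring

/-! ### Mollification of `H¹_loc` functions -/

section

variable {d : ℕ}

local notation "𝔼" => EuclideanSpace ℝ (Fin d)

theorem MemL2loc.locallyIntegrable {F : Type*} [NormedAddCommGroup F] {f : 𝔼 → F}
    (hf : MemL2loc f) : LocallyIntegrable f := by
  rw [locallyIntegrable_iff]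
  intro K hK
  have : IsFiniteMeasure (volume.restrict K) := ⟨by simpa using hK.measure_lt_top⟩
  exact (hf K hK).integrable (by norm_num)

/-- The mollification of `u` by the normalized bump function `φ`. -/
noncomputable def mollify (φ : ContDiffBump (0 : 𝔼)) (u : 𝔼 → ℝ) : 𝔼 → ℝ :=
  φ.normed volume ⋆[lsmul ℝ ℝ, volume] u

theorem contDiff_mollify (φ : ContDiffBump (0 : 𝔼)) {u : 𝔼 → ℝ} (hu : LocallyIntegrable u) :
    ContDiff ℝ 1 (mollify φ u) :=
  φ.hasCompactSupport_normed.contDiff_convolution_left (n := 1) _ φ.contDiff_normed hu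

theorem lintegral_enorm_normed (φ : ContDiffBump (0 : 𝔼)) :
    ∫⁻ x, ‖φ.normed volume x‖ₑ = 1 := by
  have := ofReal_integral_eq_lintegral_ofReal (μ := volume) φ.integrable_normed
    (.of_forall fun x ↦ φ.nonneg_normed x)
  rw [φ.integral_normed, ENNReal.ofReal_one] at this
  rw [this]
  exact lintegral_congr fun x ↦ Real.enorm_of_nonneg (φ.nonneg_normed x)

theorem normed_eq_zero_of_notMem_ball (φ : ContDiffBump (0 : 𝔼)) {x : 𝔼}
    (hx : x ∉ ball 0 φ.rOut) : φ.normed volume x = 0 := by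
  rwa [← φ.support_normed_eq (μ := volume), Function.notMem_support] at hx

/-- The derivative falls on the kernel, and `y ↦ k (x - y)` is an admissible test function; the sign
from the reflection cancels the one in the weak gradient. The right-hand side is a pairing of `g`
with a continuous, compactly supported field, so weak convergence applies to it as it stands. -/
theorem fderiv_mollify_apply (φ : ContDiffBump (0 : 𝔼)) {u : 𝔼 → ℝ} {g : 𝔼 → 𝔼}
    (hu : IsH1loc u g) (x v : 𝔼) :
    fderiv ℝ (mollify φ u) x v = ∫ y, inner ℝ (g y) (φ.normed volume (x - y) • v) := by
  set k := φ.normed (volume : Measure 𝔼) with hk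
  have hkc : ContDiff ℝ ∞ k := φ.contDiff_normed
  have hks : HasCompactSupport k := φ.hasCompactSupport_normed
  have hul := hu.memL2loc.locallyIntegrable
  have hgl := hu.memL2loc_grad.locallyIntegrable
  have hψs : HasCompactSupport fun y ↦ k (x - y) := hks.comp_homeomorph (Homeomorph.subLeft x)
  have hψc : ContDiff ℝ ∞ fun y ↦ k (x - y) := hkc.comp (contDiff_const.sub contDiff_id)
  have hi : ∀ v, fderiv ℝ (mollify φ u) x v = ∫ y, u y * fderiv ℝ k (x - y) v := by
    intro v
    rw [mollify, (hks.hasFDerivAt_convolution_left (lsmul ℝ ℝ) (hkc.of_le (by simp)) hul x).fderiv,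
      convolution_def, ContinuousLinearMap.integral_apply,
      ← integral_sub_left_eq_self _ volume x]
    · refine integral_congr_ae (.of_forall fun y ↦ ?_)
      simp [precompL_apply, mul_comm, hk]
    · exact (hks.fderiv ℝ).convolutionExists_left _ (hkc.continuous_fderiv (by simp)) hul x
  have hint : ∀ v : 𝔼, Integrable fun y ↦ inner ℝ (g y) (k (x - y) • v) := by
    intro v
    have := hgl.integrable_smul_left_of_hasCompactSupport hψc.continuous hψs
    refine (this.inner_const v).congr (.of_forall fun y ↦ ?_)
    simp [inner_smul_left, inner_smul_right]
  have hb : ∀ i, fderiv ℝ (mollify φ u) x (EuclideanSpace.single i 1) =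
      ∫ y, inner ℝ (g y) (k (x - y) • EuclideanSpace.single i (1 : ℝ)) := by
    intro i
    have h := hu.hasWeakGradient _ hψc hψs i
    have e : ∀ y, fderiv ℝ (fun y ↦ k (x - y)) y (EuclideanSpace.single i 1) =
        - fderiv ℝ k (x - y) (EuclideanSpace.single i 1) := by
      intro y
      have h1 : HasFDerivAt (fun y : 𝔼 ↦ x - y) (-ContinuousLinearMap.id ℝ 𝔼) y :=
        (hasFDerivAt_id y).const_sub x
      have h2 : HasFDerivAt (fun y ↦ k (x - y)) _ y :=
        (hkc.differentiable (by simp) (x - y)).hasFDerivAt.comp y h1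
      rw [h2.fderiv]
      simp
    simp only [e, mul_neg, integral_neg, neg_inj] at h
    rw [hi, h]
    refine integral_congr_ae (.of_forall fun y ↦ ?_)
    simp [inner_smul_right, EuclideanSpace.inner_single_right, mul_comm]
  have hv : v = ∑ i, v i • EuclideanSpace.single i (1 : ℝ) := by
    ext j
    simp [Finset.sum_apply, Pi.single_apply]
  conv_lhs => rw [hv]
  conv_rhs => enter [2, y]; rw [hv]
  simp only [map_sum, map_smul, hb, Finset.smul_sum, inner_sum]
  rw [integral_finsetSum]
  · refine Finset.sum_congr rfl fun i _ ↦ ?_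
    rw [smul_eq_mul, ← integral_const_mul]
    refine integral_congr_ae (.of_forall fun y ↦ ?_)
    simp [inner_smul_right]
    ring
  · intro i _
    exact hint _

theorem enorm_fderiv_mollify_le (φ : ContDiffBump (0 : 𝔼)) {u : 𝔼 → ℝ} {g : 𝔼 → 𝔼}
    (hu : IsH1loc u g) (x : 𝔼) :
    ‖fderiv ℝ (mollify φ u) x‖ₑ ≤ ∫⁻ y, ‖φ.normed volume y‖ₑ * ‖g (x - y)‖ₑ := by
  have h : ∀ v, ‖fderiv ℝ (mollify φ u) x v‖ₑ ≤
      (∫⁻ y, ‖φ.normed volume y‖ₑ * ‖g (x - y)‖ₑ) * ‖v‖ₑ := fun v ↦ by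
    rw [← lintegral_sub_left_eq_self (fun y ↦ ‖φ.normed volume y‖ₑ * ‖g (x - y)‖ₑ) x,
      fderiv_mollify_apply φ hu, ← lintegral_mul_const' _ _ enorm_ne_top]
    refine (enorm_integral_le_lintegral_enorm _).trans (lintegral_mono fun y ↦ ?_)
    simp only [sub_sub_cancel]
    rw [inner_smul_right, enorm_mul, mul_assoc]
    gcongr
    rw [← ofReal_norm, ← ofReal_norm, ← ofReal_norm, ← ENNReal.ofReal_mul (norm_nonneg _)]
    exact ENNReal.ofReal_le_ofReal (norm_inner_le_norm (𝕜 := ℝ) (g y) v)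
  generalize ∫⁻ y, ‖φ.normed volume y‖ₑ * ‖g (x - y)‖ₑ = I at h ⊢
  -- The operator norm bound takes a finite constant; an infinite one leaves nothing to prove.
  cases I with
  | top => exact le_top
  | coe I => exact opENorm_le_bound _ h

theorem enorm_fderiv_mollify_sq_le (φ : ContDiffBump (0 : 𝔼)) {u : 𝔼 → ℝ} {g : 𝔼 → 𝔼}
    (hu : IsH1loc u g) (hgm : Measurable g) (x : 𝔼) :
    ‖fderiv ℝ (mollify φ u) x‖ₑ ^ 2 ≤ ∫⁻ y, ‖φ.normed volume y‖ₑ * ‖g (x - y)‖ₑ ^ 2 :=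
  (pow_le_pow_left' (enorm_fderiv_mollify_le φ hu x) 2).trans <|
    sq_lintegral_mul_le φ.continuous_normed.enorm.measurable.aemeasurable
      (by fun_prop) (lintegral_enorm_normed φ).le

theorem lintegral_ball_fderiv_mollify_sq_le (φ : ContDiffBump (0 : 𝔼)) {u : 𝔼 → ℝ} {g : 𝔼 → 𝔼}
    (hu : IsH1loc u g) (hgm : Measurable g) {r s : ℝ} (hs : r + φ.rOut ≤ s) :
    ∫⁻ x in ball 0 r, ‖fderiv ℝ (mollify φ u) x‖ₑ ^ 2 ≤ ∫⁻ x in ball 0 s, ‖g x‖ₑ ^ 2 :=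
  (lintegral_mono fun x ↦ enorm_fderiv_mollify_sq_le φ hu hgm x).trans <|
    lintegral_ball_lintegral_kernel_sub_le (f := fun x ↦ ‖g x‖ₑ ^ 2) volume
      φ.continuous_normed.enorm.measurable
      (by fun_prop) (lintegral_enorm_normed φ).le
      (fun x hx ↦ by simp [normed_eq_zero_of_notMem_ball φ hx]) hs

/-- The smooth estimate applies to mollifications of `u`, which converge almost everywhere, and
Fatou's lemma passes to the limit. The strict inequality `hs` leaves room for the mollification
radius. -/
theorem IsH1loc.lintegral_ball_translate_sub_sq_le {u : 𝔼 → ℝ} {g : 𝔼 → 𝔼} (hu : IsH1loc u g)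
    (hgm : Measurable g) {r s : ℝ} {h : 𝔼} (hs : r + ‖h‖ < s) :
    ∫⁻ x in ball 0 r, ‖u (x + h) - u x‖ₑ ^ 2 ≤ ‖h‖ₑ ^ 2 * ∫⁻ x in ball 0 s, ‖g x‖ₑ ^ 2 := by
  set δ := s - r - ‖h‖ with hδ
  have hδ0 : 0 < δ := by linarith
  -- The ratio of outer to inner radius stays equal to `2`; almost everywhere convergence needs it
  -- bounded.
  let φ : ℕ → ContDiffBump (0 : 𝔼) := fun n ↦
    ⟨δ / (n + 1) / 2, δ / (n + 1), by positivity, half_lt_self (by positivity)⟩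
  have hφ : Tendsto (fun n ↦ (φ n).rOut) atTop (𝓝 0) := by
    simpa [φ, div_eq_mul_inv] using (tendsto_one_div_add_atTop_nhds_zero_nat (𝕜 := ℝ)).const_mul δ
  have hae := ContDiffBump.ae_convolution_tendsto_right_of_locallyIntegrable (μ := volume) (K := 2)
    hφ (.of_forall fun n ↦ by simp only [φ]; linarith) hu.memL2loc.locallyIntegrable
  have hae' := (measurePreserving_add_right (volume : Measure 𝔼) h).quasiMeasurePreserving.ae hae
  have hcd n := contDiff_mollify (φ n) hu.memL2loc.locallyIntegrable
  have hlim : ∀ᵐ x ∂volume.restrict (ball (0 : 𝔼) r),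
      Tendsto (fun n ↦ ‖mollify (φ n) u (x + h) - mollify (φ n) u x‖ₑ ^ 2) atTop
        (𝓝 (‖u (x + h) - u x‖ₑ ^ 2)) := by
    refine ae_restrict_of_ae ?_
    filter_upwards [hae, hae'] with x h1 h2
    exact ((ENNReal.continuous_pow 2).tendsto _).comp (h2.sub h1).enorm
  calc _ = ∫⁻ x in ball 0 r, liminf
        (fun n ↦ ‖mollify (φ n) u (x + h) - mollify (φ n) u x‖ₑ ^ 2) atTop :=
        lintegral_congr_ae (hlim.mono fun x hx ↦ hx.liminf_eq.symm)
    _ ≤ liminf (fun n ↦ ∫⁻ x in ball 0 r,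
          ‖mollify (φ n) u (x + h) - mollify (φ n) u x‖ₑ ^ 2) atTop :=
        lintegral_liminf_le fun n ↦ by
          have := (hcd n).continuous
          have : Continuous fun x ↦ mollify (φ n) u (x + h) - mollify (φ n) u x := by fun_prop
          exact this.enorm.measurable.pow_const 2
    _ ≤ liminf (fun n : ℕ ↦ ‖h‖ₑ ^ 2 * ∫⁻ x in ball 0 s, ‖g x‖ₑ ^ 2) atTop := by
        refine liminf_le_liminf (.of_forall fun n ↦ ?_)
        refine (lintegral_ball_translate_sub_sq_le_of_contDiff volume (hcd n) le_rfl).trans ?_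
        refine mul_le_mul_right (lintegral_ball_fderiv_mollify_sq_le _ hu hgm ?_) _
        have : (φ n).rOut ≤ δ := div_le_self hδ0.le (by linarith [n.cast_nonneg (α := ℝ)])
        linarith
    _ = _ := by simp

/-- The difference is a kernel average of `u x - u (x - y)` with `‖y‖ < φ.rOut`, so Cauchy–Schwarz
and Tonelli reduce it to the translation estimate. -/
theorem IsH1loc.lintegral_ball_sub_mollify_sq_le {u : 𝔼 → ℝ} {g : 𝔼 → 𝔼} (hu : IsH1loc u g)
    (hum : Measurable u) (hgm : Measurable g) (φ : ContDiffBump (0 : 𝔼)) {r s : ℝ}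
    (hs : r + φ.rOut < s) :
    ∫⁻ x in ball 0 r, ‖u x - mollify φ u x‖ₑ ^ 2 ≤
      ENNReal.ofReal φ.rOut ^ 2 * ∫⁻ x in ball 0 s, ‖g x‖ₑ ^ 2 := by
  set k := φ.normed (volume : Measure 𝔼) with hk
  have hkm : Measurable fun y ↦ ‖k y‖ₑ := φ.continuous_normed.enorm.measurable
  have hpt : ∀ x, ‖u x - mollify φ u x‖ₑ ^ 2 ≤ ∫⁻ y, ‖k y‖ₑ * ‖u (x + -y) - u x‖ₑ ^ 2 := by
    intro x
    refine le_trans (pow_le_pow_left' ?_ 2) (sq_lintegral_mul_le hkm.aemeasurable (by fun_prop)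
      (lintegral_enorm_normed φ).le)
    have hex : Integrable fun t ↦ k t * u (x - t) :=
      φ.hasCompactSupport_normed.convolutionExists_left (lsmul ℝ ℝ) φ.continuous_normed
        hu.memL2loc.locallyIntegrable x
    have e : mollify φ u x - u x = ∫ y, k y * (u (x + -y) - u x) := by
      simp only [mul_sub, ← sub_eq_add_neg]
      rw [integral_sub hex (φ.integrable_normed.mul_const _), integral_mul_const,
        φ.integral_normed, one_mul]
      rfl
    rw [enorm_sub_rev, e]
    refine (enorm_integral_le_lintegral_enorm _).trans (lintegral_mono fun y ↦ ?_)
    rw [enorm_mul]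
  calc _ ≤ ∫⁻ x in ball 0 r, ∫⁻ y, ‖k y‖ₑ * ‖u (x + -y) - u x‖ₑ ^ 2 := lintegral_mono hpt
    _ = ∫⁻ y, ∫⁻ x in ball 0 r, ‖k y‖ₑ * ‖u (x + -y) - u x‖ₑ ^ 2 :=
        lintegral_lintegral_swap <| Measurable.aemeasurable <|
          (hkm.comp measurable_snd).mul (((hum.comp (measurable_fst.add measurable_snd.neg)).sub
            (hum.comp measurable_fst)).enorm.pow_const 2)
    _ ≤ ∫⁻ y, ‖k y‖ₑ * (ENNReal.ofReal φ.rOut ^ 2 * ∫⁻ x in ball 0 s, ‖g x‖ₑ ^ 2) := by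
        refine lintegral_mono fun y ↦ ?_
        rw [lintegral_const_mul _ (by fun_prop)]
        by_cases hy : y ∈ ball 0 φ.rOut
        · refine mul_le_mul_right ?_ _
          rw [mem_ball_zero_iff] at hy
          refine (hu.lintegral_ball_translate_sub_sq_le hgm (s := s)
            (by rw [norm_neg]; linarith)).trans ?_
          rw [enorm_neg, ← ofReal_norm]
          gcongr
        · simp [hk, normed_eq_zero_of_notMem_ball φ hy]
    _ = _ := by rw [lintegral_mul_const _ hkm, lintegral_enorm_normed φ, one_mul]

theorem EuclideanSpace.norm_le_sum_norm (v : 𝔼) : ‖v‖ ≤ ∑ i, ‖v i‖ := by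
  have hv : v = ∑ i, v i • EuclideanSpace.single i (1 : ℝ) := by
    ext j
    simp [Finset.sum_apply, Pi.single_apply]
  conv_lhs => rw [hv]
  refine (norm_sum_le _ _).trans (Finset.sum_le_sum fun i _ ↦ ?_)
  simp [norm_smul]

theorem EuclideanSpace.opNorm_le_sum_norm (L : 𝔼 →L[ℝ] ℝ) :
    ‖L‖ ≤ ∑ i, ‖L (EuclideanSpace.single i 1)‖ := by
  refine L.opNorm_le_bound (by positivity) fun v ↦ ?_
  have hv : v = ∑ i, v i • EuclideanSpace.single i (1 : ℝ) := by
    ext j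
    simp [Finset.sum_apply, Pi.single_apply]
  conv_lhs => rw [hv]
  rw [map_sum, Finset.sum_mul]
  refine (norm_sum_le _ _).trans (Finset.sum_le_sum fun i _ ↦ ?_)
  rw [map_smul, norm_smul, mul_comm]
  gcongr
  exact PiLp.norm_apply_le v i

/-- This pointwise bound provides the dominating constant for dominated convergence. -/
theorem enorm_fderiv_mollify_sq_le_of_bound (φ : ContDiffBump (0 : 𝔼)) {u : 𝔼 → ℝ} {g : 𝔼 → 𝔼}
    (hu : IsH1loc u g) (hgm : Measurable g) {C : ℝ≥0∞}
    (hC : ∀ x, ‖φ.normed volume x‖ₑ ≤ C) {s : ℝ} {x : 𝔼} (hs : ‖x‖ + φ.rOut ≤ s) :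
    ‖fderiv ℝ (mollify φ u) x‖ₑ ^ 2 ≤ C * ∫⁻ y in ball 0 s, ‖g y‖ₑ ^ 2 := by
  refine (enorm_fderiv_mollify_sq_le φ hu hgm x).trans ?_
  rw [← lintegral_sub_left_eq_self _ x, ← lintegral_const_mul _ (by fun_prop),
    ← lintegral_indicator measurableSet_ball]
  refine lintegral_mono fun y ↦ ?_
  simp only [sub_sub_cancel]
  by_cases hy : x - y ∈ ball 0 φ.rOut
  · rw [indicator_of_mem]
    · gcongr
      exact hC _
    · rw [mem_ball_zero_iff] at hy ⊢
      have := norm_sub_le x (x - y)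
      rw [sub_sub_cancel] at this
      linarith
  · simp [normed_eq_zero_of_notMem_ball φ hy]

/-! ### Rellich's theorem for gradients tending weakly to zero -/

variable {ι : Type*} {l : Filter ι} {v : ι → EuclideanSpace ℝ (Fin d) → ℝ}
  {g : ι → EuclideanSpace ℝ (Fin d) → EuclideanSpace ℝ (Fin d)}

theorem tendsto_enorm_fderiv_mollify (φ : ContDiffBump (0 : 𝔼))
    (hv : ∀ᶠ i in l, IsH1loc (v i) (g i)) {s : ℝ}
    (hw : ∀ F : 𝔼 → 𝔼, Continuous F → (∀ x, x ∉ ball 0 s → F x = 0) →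
      Tendsto (fun i ↦ ∫ x, inner ℝ (g i x) (F x)) l (𝓝 0)) {x : 𝔼} (hs : ‖x‖ + φ.rOut ≤ s) :
    Tendsto (fun i ↦ ‖fderiv ℝ (mollify φ (v i)) x‖ₑ) l (𝓝 0) := by
  have h : ∀ w : 𝔼, Tendsto (fun i ↦ ‖fderiv ℝ (mollify φ (v i)) x w‖) l (𝓝 0) := by
    intro w
    rw [← norm_zero (E := ℝ)]
    refine Tendsto.norm ?_
    have := hw (fun y ↦ φ.normed volume (x - y) • w)
      ((φ.continuous_normed.comp (by fun_prop)).smul continuous_const) (fun y hy ↦ by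
        rw [normed_eq_zero_of_notMem_ball, zero_smul]
        contrapose! hy
        rw [mem_ball_zero_iff] at hy ⊢
        have := norm_sub_le x (x - y)
        rw [sub_sub_cancel] at this
        linarith)
    refine this.congr' ?_
    filter_upwards [hv] with i hi
    rw [fderiv_mollify_apply φ hi]
  have hsum : Tendsto (fun i ↦ ∑ j, ‖fderiv ℝ (mollify φ (v i)) x (EuclideanSpace.single j 1)‖) l
      (𝓝 0) := by
    simpa using tendsto_finsetSum Finset.univ fun j _ ↦ h (EuclideanSpace.single j 1)
  have := squeeze_zero (fun i ↦ norm_nonneg _)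
    (fun i ↦ EuclideanSpace.opNorm_le_sum_norm (fderiv ℝ (mollify φ (v i)) x)) hsum
  simpa [ofReal_norm] using ENNReal.tendsto_ofReal this

theorem tendsto_lintegral_ball_mollify_sub_sq [l.IsCountablyGenerated] (φ : ContDiffBump (0 : 𝔼))
    (hv : ∀ᶠ i in l, IsH1loc (v i) (g i)) (hgm : ∀ i, Measurable (g i)) {M : ℝ≥0∞} (hM : M ≠ ⊤)
    {r s : ℝ} (hg : ∀ᶠ i in l, ∫⁻ x in ball 0 s, ‖g i x‖ₑ ^ 2 ≤ M)
    (hw : ∀ F : 𝔼 → 𝔼, Continuous F → (∀ x, x ∉ ball 0 s → F x = 0) →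
      Tendsto (fun i ↦ ∫ x, inner ℝ (g i x) (F x)) l (𝓝 0)) (hs : r + φ.rOut ≤ s) :
    Tendsto (fun i ↦ ∫⁻ x in ball 0 r, ‖mollify φ (v i) x - mollify φ (v i) 0‖ₑ ^ 2) l (𝓝 0) := by
  obtain ⟨C, hC⟩ := (φ.hasCompactSupport_normed (μ := volume)).exists_bound_of_continuous
    φ.continuous_normed
  have hC' : ∀ x, ‖φ.normed volume x‖ₑ ≤ ENNReal.ofReal C := fun x ↦ by
    rw [← ofReal_norm]
    exact ENNReal.ofReal_le_ofReal (hC x)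
  -- Integrating over the ball and over the ray parameter at once lets a single dominated
  -- convergence treat all gradients at `t • x`.
  set ν : Measure (𝔼 × ℝ) := (volume.restrict (ball 0 r)).prod (volume.restrict (Icc 0 1)) with hν
  have : IsFiniteMeasure (volume.restrict (ball (0 : 𝔼) r)) := ⟨by simpa using measure_ball_lt_top⟩
  have hmem : ∀ᵐ p ∂ν, ‖p.2 • p.1‖ + φ.rOut ≤ s := by
    have : ∀ᵐ p ∂ν, p ∈ ball (0 : 𝔼) r ×ˢ Icc (0 : ℝ) 1 := by
      rw [hν, Measure.prod_restrict]
      exact ae_restrict_mem (measurableSet_ball.prod measurableSet_Icc)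
    filter_upwards [this] with p hp
    have h1 := mem_ball_zero_iff.1 hp.1
    rw [norm_smul, Real.norm_of_nonneg hp.2.1]
    nlinarith [hp.2.2, norm_nonneg p.1]
  have hcont : ∀ i, IsH1loc (v i) (g i) →
      Continuous fun p : 𝔼 × ℝ ↦ ‖fderiv ℝ (mollify φ (v i)) (p.2 • p.1)‖ₑ ^ 2 := fun i hi ↦
    (ENNReal.continuous_pow 2).comp (((contDiff_mollify φ hi.memL2loc.locallyIntegrable
      ).continuous_fderiv one_ne_zero).comp (by fun_prop)).enorm
  have hlim : Tendsto (fun i ↦ ∫⁻ p, ‖fderiv ℝ (mollify φ (v i)) (p.2 • p.1)‖ₑ ^ 2 ∂ν) l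
      (𝓝 (∫⁻ _, 0 ∂ν)) := by
    refine tendsto_lintegral_filter_of_dominated_convergence (fun _ ↦ ENNReal.ofReal C * M)
      ?_ ?_ ?_ ?_
    · filter_upwards [hv] with i hi
      exact (hcont i hi).measurable
    · filter_upwards [hv, hg] with i hi hgi
      filter_upwards [hmem] with p hp
      exact (enorm_fderiv_mollify_sq_le_of_bound φ hi (hgm i) hC' hp).trans
        (mul_le_mul_right hgi _)
    · rw [lintegral_const]
      exact ENNReal.mul_ne_top (ENNReal.mul_ne_top ENNReal.ofReal_ne_top hM)
        (measure_ne_top _ _)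
    · filter_upwards [hmem] with p hp
      simpa [Function.comp_def] using ((ENNReal.continuous_pow 2).tendsto 0).comp
        (tendsto_enorm_fderiv_mollify φ hv hw hp)
  have hlim' := ENNReal.Tendsto.const_mul (a := ENNReal.ofReal r ^ 2) hlim
    (Or.inr (ENNReal.pow_ne_top ENNReal.ofReal_ne_top))
  rw [lintegral_zero, mul_zero] at hlim'
  refine tendsto_of_tendsto_of_tendsto_of_le_of_le' tendsto_const_nhds hlim'
    (.of_forall fun _ ↦ zero_le) ?_
  filter_upwards [hv] with i hi
  rw [hν, lintegral_prod _ (hcont i hi).measurable.aemeasurable,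
    ← lintegral_const_mul' _ _ (ENNReal.pow_ne_top ENNReal.ofReal_ne_top)]
  refine setLIntegral_mono' measurableSet_ball fun x hx ↦ ?_
  have := enorm_sub_sq_le_lintegral_fderiv
    (contDiff_mollify φ hi.memL2loc.locallyIntegrable) 0 x
  simp only [zero_add] at this
  refine this.trans (mul_le_mul_left (pow_le_pow_left' ?_ 2) _)
  rw [← ofReal_norm]
  exact ENNReal.ofReal_le_ofReal (mem_ball_zero_iff.1 hx).le

/-- A form of Rellich's theorem: if the gradients are bounded in `L²` and tend weakly to `0`, then
the functions tend to constants in `L²` on smaller balls. -/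
theorem eventually_exists_lintegral_ball_sub_sq_le [l.IsCountablyGenerated]
    (hv : ∀ᶠ i in l, IsH1loc (v i) (g i)) (hvm : ∀ i, Measurable (v i))
    (hgm : ∀ i, Measurable (g i)) {M : ℝ≥0∞} (hM : M ≠ ⊤)
    {r s : ℝ} (hrs : r < s) (hg : ∀ᶠ i in l, ∫⁻ x in ball 0 s, ‖g i x‖ₑ ^ 2 ≤ M)
    (hw : ∀ F : 𝔼 → 𝔼, Continuous F → (∀ x, x ∉ ball 0 s → F x = 0) →
      Tendsto (fun i ↦ ∫ x, inner ℝ (g i x) (F x)) l (𝓝 0)) {ε : ℝ≥0∞} (hε : ε ≠ 0) :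
    ∀ᶠ i in l, ∃ c : ℝ, ∫⁻ x in ball 0 r, ‖v i x - c‖ₑ ^ 2 ≤ ε := by
  have hε4 : 0 < ε / 4 := ENNReal.div_pos hε (by norm_num)
  -- The scale `δ` is fixed before the limit: the mollification error is below `ε / 4` for every
  -- index with the gradient bound. The oscillation of the mollified function is eventually below `ε
  -- / 4` too, and `(a + b)² ≤ 2 (a² + b²)` gives `ε`.
  obtain ⟨δ, hδ0, hδs, hδ⟩ : ∃ δ : ℝ, 0 < δ ∧ r + δ < s ∧ ENNReal.ofReal δ ^ 2 * M < ε / 4 := by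
    have h1 : Tendsto (fun δ : ℝ ↦ ENNReal.ofReal δ ^ 2 * M) (𝓝[>] 0) (𝓝 0) := by
      have : Tendsto (fun δ : ℝ ↦ ENNReal.ofReal δ ^ 2) (𝓝[>] 0) (𝓝 0) := by
        have : Continuous fun δ : ℝ ↦ ENNReal.ofReal δ ^ 2 :=
          (ENNReal.continuous_pow 2).comp ENNReal.continuous_ofReal
        simpa using (this.tendsto 0).mono_left nhdsWithin_le_nhds
      simpa using ENNReal.Tendsto.mul_const this (Or.inr hM)
    have h2 : ∀ᶠ δ in 𝓝[>] (0 : ℝ), δ < s - r :=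
      nhdsWithin_le_nhds (eventually_lt_nhds (by linarith))
    obtain ⟨δ, h3, h4, h5⟩ :=
      ((h1.eventually (gt_mem_nhds hε4)).and (h2.and self_mem_nhdsWithin)).exists
    exact ⟨δ, h5, by linarith, h3⟩
  let φ : ContDiffBump (0 : 𝔼) := ⟨δ / 2, δ, by positivity, half_lt_self hδ0⟩
  have hlim := tendsto_lintegral_ball_mollify_sub_sq (r := r) φ hv hgm hM hg hw hδs.le
  filter_upwards [hv, hg, hlim.eventually (gt_mem_nhds hε4)] with i hi hgi hWi
  refine ⟨mollify φ (v i) 0, ?_⟩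
  have hWm : Measurable (mollify φ (v i)) :=
    (contDiff_mollify φ hi.memL2loc.locallyIntegrable).continuous.measurable
  have hsq : ∀ a b : ℝ≥0∞, (a + b) ^ 2 ≤ 2 * (a ^ 2 + b ^ 2) := fun a b ↦ by
    have := ENNReal.rpow_add_le_mul_rpow_add_rpow a b (p := 2) (by norm_num)
    norm_num at this
    exact this
  have hvm' := hvm i
  calc _ ≤ ∫⁻ x in ball 0 r, 2 * (‖v i x - mollify φ (v i) x‖ₑ ^ 2 +
          ‖mollify φ (v i) x - mollify φ (v i) 0‖ₑ ^ 2) := by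
        refine lintegral_mono fun x ↦ (pow_le_pow_left' ?_ 2).trans (hsq _ _)
        rw [← sub_add_sub_cancel (v i x) (mollify φ (v i) x)]
        exact enorm_add_le _ _
    _ = 2 * ((∫⁻ x in ball 0 r, ‖v i x - mollify φ (v i) x‖ₑ ^ 2) +
          ∫⁻ x in ball 0 r, ‖mollify φ (v i) x - mollify φ (v i) 0‖ₑ ^ 2) := by
        rw [lintegral_const_mul _ (by fun_prop), lintegral_add_left (by fun_prop)]
    _ ≤ 2 * (ε / 4 + ε / 4) := by
        gcongr
        refine ((hi.lintegral_ball_sub_mollify_sq_le hvm' (hgm i) φ hδs).trans ?_).trans hδ.le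
        exact mul_le_mul_right hgi _
    _ = ε := by
        rw [← two_mul, ← mul_assoc, show (2 : ℝ≥0∞) * 2 = 4 by norm_num,
          ENNReal.mul_div_cancel (by norm_num) (by norm_num)]

/-! ### Change of representative and rescaling -/

theorem MemL2loc.congr_ae {F : Type*} [NormedAddCommGroup F] {f f' : 𝔼 → F}
    (hf : MemL2loc f) (h : f =ᵐ[volume] f') : MemL2loc f' := fun K hK ↦
  (hf K hK).ae_eq (ae_restrict_of_ae h)

theorem IsH1loc.congr_ae {u u' : 𝔼 → ℝ} {g g' : 𝔼 → 𝔼} (hu : IsH1loc u g)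
    (h : u =ᵐ[volume] u') (h' : g =ᵐ[volume] g') : IsH1loc u' g' where
  memL2loc := hu.memL2loc.congr_ae h
  memL2loc_grad := hu.memL2loc_grad.congr_ae h'
  hasWeakGradient φ hφ hs i := by
    have e := hu.hasWeakGradient φ hφ hs i
    rw [integral_congr_ae (h'.mono fun x hx ↦ congrArg (fun v : 𝔼 ↦ v i * φ x) hx)] at e
    rw [← e]
    exact integral_congr_ae (h.mono fun x hx ↦ congrArg (· * _) hx.symm)

theorem MemL2loc.comp_smul {F : Type*} [NormedAddCommGroup F] {f : 𝔼 → F} (hf : MemL2loc f)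
    {R : ℝ} (hR : R ≠ 0) : MemL2loc fun x ↦ f (R • x) := by
  intro K hK
  have he : MeasurableEmbedding fun x : 𝔼 ↦ R • x := measurableEmbedding_const_smul₀ hR
  have h1 : MemLp f 2 ((volume.restrict K).map fun x : 𝔼 ↦ R • x) := by
    have h2 : (fun x : 𝔼 ↦ R • x) ⁻¹' (R • K) = K := preimage_image_eq K he.injective
    have h3 : ((volume : Measure 𝔼).map fun x : 𝔼 ↦ R • x) = _ :=
      Measure.map_addHaar_smul volume hR
    rw [← h2, ← he.restrict_map, h3, Measure.restrict_smul]
    exact (hf _ (hK.smul R)).smul_measure ENNReal.ofReal_ne_top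
  exact he.memLp_map_measure_iff.1 h1

theorem IsH1loc.comp_smul {u : 𝔼 → ℝ} {g : 𝔼 → 𝔼} (hu : IsH1loc u g) {R : ℝ} (hR : R ≠ 0) :
    IsH1loc (fun x ↦ R⁻¹ * u (R • x)) fun x ↦ g (R • x) where
  memL2loc K hK := (hu.memL2loc.comp_smul hR K hK).const_mul R⁻¹
  memL2loc_grad := hu.memL2loc_grad.comp_smul hR
  hasWeakGradient φ hφ hs i := by
    have hψ : ContDiff ℝ ∞ fun y : 𝔼 ↦ φ (R⁻¹ • y) := hφ.comp (contDiff_const_smul R⁻¹)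
    have e := hu.hasWeakGradient _ hψ (hs.comp_smul (inv_ne_zero hR)) i
    have h1 : ∀ y, fderiv ℝ (fun y : 𝔼 ↦ φ (R⁻¹ • y)) y (EuclideanSpace.single i 1) =
        R⁻¹ * fderiv ℝ φ (R⁻¹ • y) (EuclideanSpace.single i 1) := fun y ↦ by
      have h2 : HasFDerivAt (fun y : 𝔼 ↦ φ (R⁻¹ • y)) _ y :=
        (hφ.differentiable (by simp) (R⁻¹ • y)).hasFDerivAt.comp y
          ((hasFDerivAt_id y).const_smul R⁻¹)
      rw [h2.fderiv]
      simp
    simp only [h1] at e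
    have h3 := Measure.integral_comp_smul (volume : Measure 𝔼)
      (fun y ↦ u y * (R⁻¹ * fderiv ℝ φ (R⁻¹ • y) (EuclideanSpace.single i 1))) R
    have h4 := Measure.integral_comp_smul (volume : Measure 𝔼)
      (fun y ↦ g y i * φ (R⁻¹ • y)) R
    simp only [inv_smul_smul₀ hR] at h3 h4
    rw [h4, ← smul_neg, ← e, ← h3]
    refine integral_congr_ae (.of_forall fun x ↦ ?_)
    ring

/-! ### Geometry of the unit box -/

theorem norm_lt_of_mem_unitBox {x : 𝔼} (hx : x ∈ unitBox d) : ‖x‖ < d + 1 := by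
  refine ((EuclideanSpace.norm_le_sum_norm x).trans
    (Finset.sum_le_sum (g := fun _ ↦ (1 : ℝ)) fun i _ ↦ ?_)).trans_lt ?_
  · rw [Real.norm_eq_abs, abs_le]
    constructor <;> linarith [(hx i).1, (hx i).2]
  · simp

theorem ball_subset_unitBox : ball (0 : 𝔼) (1 / 2) ⊆ unitBox d := fun x hx i ↦
  abs_lt.1 ((PiLp.norm_apply_le x i).trans_lt (mem_ball_zero_iff.1 hx))

theorem smul_unitBox_subset {r R : ℝ} (hr : 0 ≤ r) (hrR : r ≤ R) :
    r • unitBox d ⊆ R • unitBox d := by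
  rintro _ ⟨x, hx, rfl⟩
  rcases hr.eq_or_lt with rfl | hr
  · refine ⟨0, fun i ↦ by simp, by simp⟩
  · have hR : 0 < R := hr.trans_le hrR
    refine ⟨(r / R) • x, fun i ↦ ?_, ?_⟩
    · have h1 : r / R ≤ 1 := (div_le_one hR).2 hrR
      have h2 : 0 < r / R := by positivity
      have := hx i
      simp only [PiLp.smul_apply, smul_eq_mul, mem_Ioo] at this ⊢
      constructor <;> nlinarith
    · simp [smul_smul, mul_div_cancel₀ _ hR.ne']

theorem volume_unitBox : volume (unitBox d) = 1 := by
  have h := (EuclideanSpace.volume_preserving_symm_measurableEquiv_toLp (Fin d))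
  have e : unitBox d = (MeasurableEquiv.toLp 2 (Fin d → ℝ)).symm ⁻¹'
      (Set.univ.pi fun _ ↦ Ioo (-(1 / 2) : ℝ) (1 / 2)) := by
    ext x
    simp [unitBox]
  rw [e, h.measure_preimage (MeasurableSet.univ_pi fun _ ↦ measurableSet_Ioo).nullMeasurableSet,
    Real.volume_pi_Ioo]
  norm_num

theorem measurableSet_unitBox : MeasurableSet (unitBox d) := by
  have : unitBox d = ⋂ i, {x | x i ∈ Ioo (-(1 / 2) : ℝ) (1 / 2)} := by
    ext x
    simp [unitBox]
  rw [this]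
  exact MeasurableSet.iInter fun i ↦ measurableSet_Ioo.preimage (by fun_prop)

instance : IsProbabilityMeasure (volume.restrict (unitBox d)) :=
  ⟨by simpa using volume_unitBox⟩

/-- The unit box has volume one, so averages at all scales become integrals over one probability
space. -/
theorem setAverage_smul_unitBox {R : ℝ} (hR : 0 < R) (f : 𝔼 → ℝ) :
    ⨍ x in R • unitBox d, f x = ∫ x in unitBox d, f (R • x) := by
  rw [Measure.setIntegral_comp_smul_of_pos volume f _ hR, setAverage_eq, measureReal_def,
    Measure.addHaar_smul, volume_unitBox, mul_one, abs_of_nonneg (by positivity),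
    ENNReal.toReal_ofReal (by positivity)]

theorem isCompact_closure_smul_unitBox (R : ℝ) : IsCompact (closure (R • unitBox d)) := by
  refine Bornology.IsBounded.isCompact_closure (Bornology.IsBounded.smul₀ ?_ R)
  exact isBounded_ball.subset fun x hx ↦ mem_ball_zero_iff.2 (norm_lt_of_mem_unitBox hx)

theorem MemL2loc.memLp_smul_unitBox {F : Type*} [NormedAddCommGroup F] {f : 𝔼 → F}
    (hf : MemL2loc f) (R : ℝ) : MemLp f 2 (volume.restrict (R • unitBox d)) :=
  (hf _ (isCompact_closure_smul_unitBox R)).mono_measure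
    (Measure.restrict_mono subset_closure le_rfl)

theorem MemL2loc.memLp_unitBox_comp_smul {F : Type*} [NormedAddCommGroup F] {f : 𝔼 → F}
    (hf : MemL2loc f) {R : ℝ} (hR : R ≠ 0) :
    MemLp (fun x ↦ f (R • x)) 2 (volume.restrict (unitBox d)) := by
  simpa using (hf.comp_smul hR).memLp_smul_unitBox 1

theorem IsH1loc.exists_measurable {u : 𝔼 → ℝ} {g : 𝔼 → 𝔼} (hu : IsH1loc u g) :
    ∃ u' g', Measurable u' ∧ Measurable g' ∧ u =ᵐ[volume] u' ∧ g =ᵐ[volume] g' := by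
  have h1 := hu.memL2loc.locallyIntegrable.aestronglyMeasurable
  have h2 := hu.memL2loc_grad.locallyIntegrable.aestronglyMeasurable
  exact ⟨h1.mk u, h2.mk g, h1.stronglyMeasurable_mk.measurable,
    h2.stronglyMeasurable_mk.measurable, h1.ae_eq_mk, h2.ae_eq_mk⟩

theorem isFiniteMeasure_restrict_smul_unitBox (R : ℝ) :
    IsFiniteMeasure (volume.restrict (R • unitBox d)) := by
  rw [isFiniteMeasure_restrict]
  exact ((measure_mono subset_closure).trans_lt
    (isCompact_closure_smul_unitBox R).measure_lt_top).ne

/-! ### The blow-down argument -/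

theorem IsH1loc.eventually_exists_setAverage_sub_sq_le_of_measurable {u : 𝔼 → ℝ} {g : 𝔼 → 𝔼}
    (hu : IsH1loc u g) (hum : Measurable u) (hgm : Measurable g) {M : ℝ}
    (hM : ∀ᶠ R : ℝ in atTop, ⨍ x in R • unitBox d, ‖g x‖ ^ 2 ≤ M)
    (hw : ∀ F : 𝔼 → 𝔼, MemLp F 2 (volume.restrict (unitBox d)) →
      Tendsto (fun R : ℝ ↦ ⨍ x in R • unitBox d, inner ℝ (g x) (F (R⁻¹ • x))) atTop (𝓝 0))
    {ε : ℝ} (hε : 0 < ε) :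
    ∀ᶠ R : ℝ in atTop, ∃ c : ℝ, ⨍ x in R • unitBox d, |u x - c| ^ 2 ≤ ε * R ^ 2 := by
  -- Rellich's theorem controls a ball inside the box, not the whole box. Hence it is applied at the
  -- larger scale `S = R / θ`, with `θ` so small that `θ□` lies in that ball; then `R□ = S(θ□)`. In
  -- the target `ε * θ ^ (d + 2)`, the power `d` pays for the volume of `θ□` and the power `2` for
  -- `S² = R² / θ²`.
  set θ : ℝ := (8 * (d + 1))⁻¹ with hθ
  have hθ0 : 0 < θ := by positivity
  have hsub : θ • unitBox d ⊆ ball (0 : 𝔼) (1 / 8) := by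
    rintro _ ⟨x, hx, rfl⟩
    rw [mem_ball_zero_iff]
    change ‖θ • x‖ < _
    rw [norm_smul, Real.norm_of_nonneg hθ0.le, hθ, inv_mul_lt_iff₀ (by positivity)]
    linarith [norm_lt_of_mem_unitBox hx]
  have hcore := eventually_exists_lintegral_ball_sub_sq_le (d := d) (l := atTop)
    (v := fun (R : ℝ) x ↦ R⁻¹ * u (R • x)) (g := fun R x ↦ g (R • x)) (r := 1 / 8) (s := 1 / 2)
    (M := ENNReal.ofReal M) (ε := ENNReal.ofReal (ε * θ ^ (d + 2)))
    ((eventually_ne_atTop 0).mono fun R hR ↦ hu.comp_smul hR) (fun R ↦ by fun_prop)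
    (fun R ↦ by fun_prop) ENNReal.ofReal_ne_top (by norm_num) ?_ ?_
    (by rw [Ne, ENNReal.ofReal_eq_zero, not_le]; positivity)
  · have hlim : Tendsto (fun R : ℝ ↦ R / θ) atTop atTop := tendsto_id.atTop_div_const hθ0
    filter_upwards [hlim.eventually hcore, eventually_gt_atTop 0] with R ⟨c, hc⟩ hR
    set S := R / θ with hS
    have hS0 : 0 < S := by positivity
    have hRS : R = S * θ := (div_mul_cancel₀ R hθ0.ne').symm
    have hmem : MemLp (fun x ↦ S⁻¹ * u (S • x) - c) 2 (volume.restrict (θ • unitBox d)) := by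
      have := isFiniteMeasure_restrict_smul_unitBox (d := d) θ
      exact ((hu.comp_smul hS0.ne').memL2loc.memLp_smul_unitBox θ).sub (memLp_const c)
    have h1 : ∫ x in θ • unitBox d, (S⁻¹ * u (S • x) - c) ^ 2 ≤ ε * θ ^ (d + 2) := by
      rw [← ENNReal.ofReal_le_ofReal_iff (by positivity),
        ofReal_integral_eq_lintegral_ofReal hmem.integrable_sq
          (.of_forall fun x ↦ sq_nonneg _)]
      refine ((lintegral_mono_set hsub).trans_eq ?_).trans hc
      refine lintegral_congr fun x ↦ ?_
      rw [← sq_abs, ENNReal.ofReal_pow (abs_nonneg _), ← Real.norm_eq_abs, ofReal_norm]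
    have h2 := Measure.setIntegral_comp_smul_of_pos (volume : Measure 𝔼)
      (fun x ↦ (S⁻¹ * u (S • x) - c) ^ 2) (unitBox d) hθ0
    rw [finrank_euclideanSpace_fin, smul_eq_mul] at h2
    refine ⟨S * c, ?_⟩
    rw [setAverage_smul_unitBox hR]
    have h3 : ∀ x : 𝔼, |u (R • x) - S * c| ^ 2 = S ^ 2 * (S⁻¹ * u (S • θ • x) - c) ^ 2 := by
      intro x
      rw [smul_smul, ← hRS, sq_abs, ← mul_pow, mul_sub, mul_inv_cancel_left₀ hS0.ne']
    simp only [h3]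
    rw [integral_const_mul, h2, hRS]
    calc _ ≤ S ^ 2 * ((θ ^ d)⁻¹ * (ε * θ ^ (d + 2))) := by gcongr
      _ = _ := by
        field_simp
        ring
  · filter_upwards [hM, eventually_gt_atTop 0] with R hR hR0
    rw [setAverage_smul_unitBox hR0] at hR
    have hmem := (hu.memL2loc_grad.memLp_unitBox_comp_smul hR0.ne').integrable_norm_pow
      (p := 2) (by norm_num)
    refine (lintegral_mono_set ball_subset_unitBox).trans ?_
    refine le_trans (le_of_eq ?_) (ENNReal.ofReal_le_ofReal hR)
    rw [ofReal_integral_eq_lintegral_ofReal (by simpa using hmem)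
      (.of_forall fun x ↦ by positivity)]
    refine lintegral_congr fun x ↦ ?_
    rw [ENNReal.ofReal_pow (norm_nonneg _), ofReal_norm]
  · intro F hF hF0
    have hFs : HasCompactSupport F := HasCompactSupport.intro (isCompact_closedBall 0 (1 / 2))
      fun x hx ↦ hF0 x fun h ↦ hx (ball_subset_closedBall h)
    refine (hw F ((hF.memLp_of_hasCompactSupport hFs).restrict _)).congr' ?_
    filter_upwards [eventually_gt_atTop 0] with R hR
    rw [setAverage_smul_unitBox hR]
    simp only [inv_smul_smul₀ hR.ne']
    refine setIntegral_eq_integral_of_forall_compl_eq_zero fun x hx ↦ ?_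
    rw [hF0 x fun h ↦ hx (ball_subset_unitBox h), inner_zero_right]

/-- Everything involved ignores null sets, so measurable representatives may replace `u` and `g`. -/
theorem IsH1loc.eventually_exists_setAverage_sub_sq_le {u : 𝔼 → ℝ} {g : 𝔼 → 𝔼}
    (hu : IsH1loc u g) {M : ℝ} (hM : ∀ᶠ R : ℝ in atTop, ⨍ x in R • unitBox d, ‖g x‖ ^ 2 ≤ M)
    (hw : ∀ F : 𝔼 → 𝔼, MemLp F 2 (volume.restrict (unitBox d)) →
      Tendsto (fun R : ℝ ↦ ⨍ x in R • unitBox d, inner ℝ (g x) (F (R⁻¹ • x))) atTop (𝓝 0))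
    {ε : ℝ} (hε : 0 < ε) :
    ∀ᶠ R : ℝ in atTop, ∃ c : ℝ, ⨍ x in R • unitBox d, |u x - c| ^ 2 ≤ ε * R ^ 2 := by
  obtain ⟨u', g', hum, hgm, hu', hg'⟩ := hu.exists_measurable
  have hcongr : ∀ (R : ℝ) {f f' : 𝔼 → ℝ}, f =ᵐ[volume] f' →
      ⨍ x in R • unitBox d, f x = ⨍ x in R • unitBox d, f' x := fun R f f' h ↦ by
    rw [setAverage_eq, setAverage_eq, integral_congr_ae (ae_restrict_of_ae h)]
  have := (hu.congr_ae hu' hg').eventually_exists_setAverage_sub_sq_le_of_measurable hum hgm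
    (M := M) (hM.mono fun R hR ↦ ?_) (fun F hF ↦ (hw F hF).congr fun R ↦ ?_) hε
  · filter_upwards [this] with R ⟨c, hc⟩
    refine ⟨c, le_of_eq_of_le (hcongr R ?_) hc⟩
    filter_upwards [hu'] with x hx
    rw [hx]
  · refine le_of_eq_of_le (hcongr R ?_) hR
    filter_upwards [hg'] with x hx
    rw [hx]
  · refine hcongr R ?_
    filter_upwards [hg'] with x hx
    rw [hx]

/-! ### Comparison of means at different scales -/

theorem MemL2loc.setAverage_sub_const_sq {u : 𝔼 → ℝ} (hu : MemL2loc u) {R : ℝ} (hR : 0 < R)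
    (c : ℝ) :
    ⨍ x in R • unitBox d, |u x - c| ^ 2 =
      (⨍ x in R • unitBox d, |u x - ⨍ y in R • unitBox d, u y| ^ 2) +
        ((⨍ y in R • unitBox d, u y) - c) ^ 2 := by
  simp only [setAverage_smul_unitBox hR]
  exact integral_sub_const_sq (hu.memLp_unitBox_comp_smul hR.ne') c

/-- The variance identity on the half box, centred at the mean of the full box, bounds the left side
by a mean square over the half box; enlarging the domain costs the volume ratio `2 ^ d`. -/
theorem MemL2loc.setAverage_half_sub_setAverage_sq_le {u : 𝔼 → ℝ} (hu : MemL2loc u) {R : ℝ}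
    (hR : 0 < R) :
    ((⨍ x in (R / 2) • unitBox d, u x) - ⨍ x in R • unitBox d, u x) ^ 2 ≤
      2 ^ d * ⨍ x in R • unitBox d, |u x - ⨍ y in R • unitBox d, u y| ^ 2 := by
  set m := ⨍ x in R • unitBox d, u x with hm
  have h1 := hu.setAverage_sub_const_sq (half_pos hR) m
  have h0 : 0 ≤ ⨍ x in (R / 2) • unitBox d, |u x - ⨍ y in (R / 2) • unitBox d, u y| ^ 2 := by
    rw [setAverage_smul_unitBox (half_pos hR)]
    positivity
  refine (show _ ≤ ⨍ x in (R / 2) • unitBox d, |u x - m| ^ 2 by linarith).trans ?_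
  have hi : IntegrableOn (fun x ↦ |u x - m| ^ 2) (R • unitBox d) := by
    have := isFiniteMeasure_restrict_smul_unitBox (d := d) R
    simpa [sq_abs, IntegrableOn] using ((hu.memLp_smul_unitBox R).sub (memLp_const m)).integrable_sq
  have h2 : ∫ x in (R / 2) • unitBox d, |u x - m| ^ 2 ≤ ∫ x in R • unitBox d, |u x - m| ^ 2 :=
    setIntegral_mono_set hi (.of_forall fun x ↦ by positivity)
      (smul_unitBox_subset (by positivity) (by linarith)).eventuallyLE
  rw [setAverage_smul_unitBox hR, setAverage_smul_unitBox (half_pos hR),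
    Measure.setIntegral_comp_smul_of_pos volume (fun x ↦ |u x - m| ^ 2) _ hR,
    Measure.setIntegral_comp_smul_of_pos volume (fun x ↦ |u x - m| ^ 2) _ (half_pos hR),
    finrank_euclideanSpace_fin, smul_eq_mul, smul_eq_mul, div_pow, inv_div, ← mul_assoc,
    ← div_eq_mul_inv]
  gcongr

/-- Supplies the starting bound of the halving recursion. -/
theorem MemL2loc.exists_abs_setAverage_le {u : 𝔼 → ℝ} (hu : MemL2loc u) {a b : ℝ} (ha : 0 < a) :
    ∃ K, ∀ R ∈ Icc a b, |⨍ x in R • unitBox d, u x| ≤ K := by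
  refine ⟨(a ^ d)⁻¹ * ∫ x in b • unitBox d, |u x|, fun R hR ↦ ?_⟩
  have hR0 : 0 < R := ha.trans_le hR.1
  have hi : IntegrableOn (fun x ↦ |u x|) (b • unitBox d) :=
    ((hu.locallyIntegrable.integrableOn_isCompact (isCompact_closure_smul_unitBox b)).mono_set
      subset_closure).abs
  rw [setAverage_smul_unitBox hR0, Measure.setIntegral_comp_smul_of_pos volume u _ hR0,
    finrank_euclideanSpace_fin, smul_eq_mul, abs_mul, abs_of_nonneg (by positivity)]
  have h1 : |∫ x in R • unitBox d, u x| ≤ ∫ x in b • unitBox d, |u x| :=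
    (abs_integral_le_integral_abs).trans <|
      setIntegral_mono_set hi (.of_forall fun x ↦ by positivity)
        (smul_unitBox_subset hR0.le hR.2).eventuallyLE
  have := hR.1
  gcongr

end

end

/-! ### Conclusion -/

theorem lemma2 (d : ℕ) (u : EuclideanSpace ℝ (Fin d) → ℝ)
    (Du : EuclideanSpace ℝ (Fin d) → EuclideanSpace ℝ (Fin d))
    (hu : IsH1loc u Du)
    (hmean : ⨍ x in unitBox d, u x = 0)
    (hbdd : limsup (fun R : ℝ => ((⨍ x in R • unitBox d, ‖Du x‖ ^ 2 : ℝ) : EReal)) atTop < ⊤)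
    (hweak : ∀ F : EuclideanSpace ℝ (Fin d) → EuclideanSpace ℝ (Fin d),
      MemLp F 2 (volume.restrict (unitBox d)) →
      Tendsto (fun R : ℝ => ⨍ x in R • unitBox d, inner ℝ (Du x) (F (R⁻¹ • x)))
        atTop (𝓝 0)) :
    Tendsto (fun R : ℝ =>
        √(1 / R ^ 2 * ⨍ x in R • unitBox d, |u x - ⨍ y in R • unitBox d, u y| ^ 2))
      atTop (𝓝 0) ∧
    Tendsto (fun R : ℝ => √(1 / R ^ 2 * ⨍ x in R • unitBox d, |u x| ^ 2))
      atTop (𝓝 0) := by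
  obtain ⟨b, hb1, -⟩ := EReal.lt_iff_exists_real_btwn.1 hbdd
  have hM : ∀ᶠ R : ℝ in atTop, ⨍ x in R • unitBox d, ‖Du x‖ ^ 2 ≤ b :=
    (eventually_lt_of_limsup_lt hb1).mono fun R hR ↦ (EReal.coe_lt_coe_iff.1 hR).le
  have hu2 := hu.memL2loc
  set m : ℝ → ℝ := fun R ↦ ⨍ y in R • unitBox d, u y with hm
  set D : ℝ → ℝ := fun R ↦ 1 / R ^ 2 * ⨍ x in R • unitBox d, |u x - m R| ^ 2 with hD
  have hD0 : ∀ R, 0 < R → 0 ≤ D R := fun R hR ↦ by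
    simp only [hD]
    rw [setAverage_smul_unitBox hR]
    positivity
  have hDlim : Tendsto D atTop (𝓝 0) := by
    rw [Metric.tendsto_nhds]
    intro ε hε
    filter_upwards [hu.eventually_exists_setAverage_sub_sq_le hM hweak (half_pos hε),
      eventually_gt_atTop 0] with R ⟨c, hc⟩ hR
    rw [Real.dist_0_eq_abs, abs_of_nonneg (hD0 R hR)]
    rw [hu2.setAverage_sub_const_sq hR] at hc
    simp only [hD]
    rw [one_div, inv_mul_lt_iff₀ (by positivity)]
    have : 0 < ε * R ^ 2 := by positivity
    -- The mean does at least as well as `c`: the extra square in the variance identity is dropped.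
    linarith [sq_nonneg ((⨍ y in R • unitBox d, u y) - c)]
  have hmlim : Tendsto (fun R ↦ |m R| / R) atTop (𝓝 0) := by
    refine tendsto_zero_of_le_half_add (fun R hR ↦ by positivity) (fun R₀ hR₀ ↦ ?_) fun ε hε ↦ ?_
    · obtain ⟨K, hK⟩ := hu2.exists_abs_setAverage_le (b := 2 * R₀) hR₀
      refine ⟨K / R₀, fun R hR ↦ ?_⟩
      have h1 := hK R hR
      have h2 := (abs_nonneg _).trans h1
      have h3 := hR.1
      gcongr
    · have h1 : Tendsto (fun R ↦ 2 ^ d * D R) atTop (𝓝 0) := by simpa using hDlim.const_mul (2 ^ d)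
      filter_upwards [h1.eventually (gt_mem_nhds (show 0 < ε ^ 2 by positivity)),
        eventually_gt_atTop 0] with R h2 hR
      have h3 := hu2.setAverage_half_sub_setAverage_sq_le hR
      have h4 : (m (R / 2) - m R) ^ 2 ≤ (ε * R) ^ 2 := by
        refine h3.trans ?_
        have h5 : ⨍ x in R • unitBox d, |u x - m R| ^ 2 = D R * R ^ 2 := by
          simp only [hD]
          field_simp
        change 2 ^ d * ⨍ x in R • unitBox d, |u x - m R| ^ 2 ≤ _
        rw [h5, ← mul_assoc, mul_pow]
        gcongr
      have h6 := abs_le_of_sq_le_sq h4 (by positivity)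
      have h7 : |m R| ≤ |m (R / 2)| + ε * R := by
        have := abs_sub_abs_le_abs_sub (m R) (m (R / 2))
        rw [abs_sub_comm] at this
        linarith
      have h8 : |m (R / 2)| / (R / 2) / 2 = |m (R / 2)| / R := by field_simp
      rw [h8, div_add' _ _ _ hR.ne']
      gcongr
  have hsqrt : Tendsto Real.sqrt (𝓝 0) (𝓝 0) := by simpa using Real.continuous_sqrt.tendsto 0
  refine ⟨hsqrt.comp hDlim, ?_⟩
  have hlim : Tendsto (fun R ↦ D R + (|m R| / R) ^ 2) atTop (𝓝 0) := by
    simpa using hDlim.add (hmlim.pow 2)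
  refine (hsqrt.comp hlim).congr' ?_
  filter_upwards [eventually_gt_atTop 0] with R hR
  -- Centring at `0` splits the mean square into the variance and the squared mean.
  have h1 := hu2.setAverage_sub_const_sq hR 0
  simp only [sub_zero] at h1
  rw [h1, Function.comp_apply, div_pow, sq_abs]
  congr 1
  simp only [hD, hm]
  ring
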